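/- A Motzkin path of length $n$ is a lattice path from $(0,0)$ to $(n,0)$ with up-steps $(1,1)$, flat-steps $(1,0)$ and down-steps $(1,-1)$ that never goes below the $x$-axis. A hump in such a path is an up-step followed immediately by zero or more flat-steps followed immediately by a down-step. Let $\mathcal{H}M_n$ denote the total number of humps in all Motzkin paths of length $n$. For a partition $\lambda=(\lambda_1\ge\lambda_2\ge\cdots)$ of $n$ (with $\lambda_i=0$ beyond the last part) let $f^\lambda$ be the number of standard Young tableaux of shape $\lambda$, and let $$S(2,1;n)=\sum_{\lambda\vdash n,\ \lambda_3\le 1} f^\lambda .$$ Then for every integer $n\ge 0$, $$\mathcal{H}M_n=S(2,1;n)-1 .$$ -/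

import Mathlib

namespace MotzkinHumps

/-! ### Motzkin paths and humps -/

/-- The three kinds of steps of a Motzkin path: up-steps `(1, 1)`, flat-steps `(1, 0)` and
down-steps `(1, -1)`. -/
inductive Step
  | up : Step
  | flat : Step
  | down : Step
  deriving DecidableEq

instance : Fintype Step :=
  ⟨{Step.up, Step.flat, Step.down}, fun s => by cases s <;> decide⟩

/-- The change of the second coordinate along a step. -/
def Step.rise : Step → ℤ
  | .up => 1
  | .flat => 0
  | .down => -1

/-- The second coordinate of the endpoint of the lattice path that starts at `(0, 0)` and has the
steps `w`; the first coordinate of the endpoint is `w.length`. -/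
def height (w : List Step) : ℤ := (w.map Step.rise).sum

/-- `w` is the list of steps of a Motzkin path of length `n`: a lattice path from `(0, 0)` to
`(n, 0)` all of whose vertices lie on or above the horizontal axis. -/
def IsMotzkinPath (n : ℕ) (w : List Step) : Prop :=
  w.length = n ∧ height w = 0 ∧ ∀ i : ℕ, 0 ≤ height (w.take i)

theorem finite_setOf_isMotzkinPath (n : ℕ) : {w : List Step | IsMotzkinPath n w}.Finite :=
  (List.finite_length_eq Step n).subset fun _ hw => hw.1

/-- The Motzkin paths of length `n`. -/
noncomputable def motzkinPaths (n : ℕ) : Finset (List Step) :=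
  (finite_setOf_isMotzkinPath n).toFinset

theorem mem_motzkinPaths {n : ℕ} {w : List Step} : w ∈ motzkinPaths n ↔ IsMotzkinPath n w := by
  simp [motzkinPaths]

/-- A hump of `w` starts at the `i`-th step (counting from `0`): this step is an up-step, and the
steps right after it are zero or more flat-steps followed by a down-step. -/
def IsHumpAt (w : List Step) (i : ℕ) : Prop :=
  ∃ m : ℕ, (Step.up :: (List.replicate m Step.flat ++ [Step.down])) <+: w.drop i

open Classical in
/-- The number of humps of a path. Distinct humps start at distinct steps, so they are counted by
their starting positions. -/
noncomputable def humps (w : List Step) : ℕ :=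
  ((Finset.range w.length).filter fun i => IsHumpAt w i).card

/-- The total number of humps in all the Motzkin paths of length `n`. -/
noncomputable def totalHumps (n : ℕ) : ℕ := ∑ w ∈ motzkinPaths n, humps w

/-! ### Standard Young tableaux

A partition `λ` of `n` is given by its Young diagram, which has `n` cells; the part `λ_{i+1}` is
the length `rowLen i` of the row with index `i` (rows are indexed from `0`). -/

/-- A standard Young tableau of shape `μ`: a filling of the `n` cells of `μ` by the numbers
`1, …, n`, each used exactly once, that increases along the rows and down the columns. -/
def IsStandard {μ : YoungDiagram} (T : SemistandardYoungTableau μ) : Prop :=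
  Set.BijOn (fun c : ℕ × ℕ => T c.1 c.2) (μ : Set (ℕ × ℕ)) (Set.Icc 1 μ.card)

/-- `f^μ`, the number of standard Young tableaux of shape `μ`. -/
noncomputable def numSYT (μ : YoungDiagram) : ℕ :=
  Nat.card {T : SemistandardYoungTableau μ // IsStandard T}

/-- There are finitely many standard Young tableaux of each shape, so that `numSYT` is a genuine
count. -/
theorem finite_standard (μ : YoungDiagram) :
    Finite {T : SemistandardYoungTableau μ // IsStandard T} := by
  let F : {T : SemistandardYoungTableau μ // IsStandard T} →
      {c : ℕ × ℕ // c ∈ μ.cells} → Set.Icc 1 μ.card :=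
    fun T c => ⟨T.1 c.1.1 c.1.2, T.2.mapsTo c.2⟩
  refine Finite.of_injective F fun T T' h => Subtype.ext ?_
  refine SemistandardYoungTableau.ext fun i j => ?_
  by_cases hc : (i, j) ∈ μ
  · exact congrArg Subtype.val (congrFun h ⟨(i, j), hc⟩)
  · rw [T.1.zeros hc, T'.1.zeros hc]

theorem finite_setOf_card_eq (n : ℕ) : {μ : YoungDiagram | μ.card = n}.Finite := by
  have hinj : Function.Injective YoungDiagram.cells := fun _ _ h => YoungDiagram.ext h
  refine Set.Finite.of_finite_image (f := YoungDiagram.cells) ?_ hinj.injOn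
  refine (Finset.finite_toSet (Finset.range n ×ˢ Finset.range n).powerset).subset ?_
  rintro _ ⟨μ, rfl, rfl⟩
  simp only [Finset.coe_powerset, Set.mem_preimage, Set.mem_powerset_iff, Finset.coe_subset]
  rintro ⟨i, j⟩ hc
  have hr : μ.rowLen i ≤ μ.card := by
    rw [YoungDiagram.rowLen_eq_card]; exact Finset.card_le_card (Finset.filter_subset _ _)
  have hl : μ.colLen j ≤ μ.card := by
    rw [YoungDiagram.colLen_eq_card]; exact Finset.card_le_card (Finset.filter_subset _ _)
  have h1 := YoungDiagram.mem_iff_lt_rowLen.1 ((YoungDiagram.mem_cells _).1 hc)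
  have h2 := YoungDiagram.mem_iff_lt_colLen.1 ((YoungDiagram.mem_cells _).1 hc)
  simp only [Finset.mem_product, Finset.mem_range]
  exact ⟨by omega, by omega⟩

/-- `H(k, l; n)`: the partitions `λ` of `n` with `λ_{k+1} ≤ l`. -/
noncomputable def hookPartitions (k l n : ℕ) : Finset YoungDiagram :=
  ((finite_setOf_card_eq n).subset
    (show {μ : YoungDiagram | μ.card = n ∧ μ.rowLen k ≤ l} ⊆ _ from fun _ h => h.1)).toFinset

theorem mem_hookPartitions {k l n : ℕ} {μ : YoungDiagram} :
    μ ∈ hookPartitions k l n ↔ μ.card = n ∧ μ.rowLen k ≤ l := by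
  simp [hookPartitions]

/-- `S(k, l; n)`: the sum of the numbers `f^λ` over the partitions `λ` in `H(k, l; n)`. -/
noncomputable def hookSum (k l n : ℕ) : ℕ := ∑ μ ∈ hookPartitions k l n, numSYT μ

end MotzkinHumps

/-! Write T(n, e) for `trinomial n e`. From `n` to `n + 1` both sides grow by T(n, 1), and both are
0 at `n = 0`.

Humps: deleting one flat-step matches the humps with a flat-step to the humps of paths one step
shorter. The remaining humps are peaks; deleting a peak leaves a path of length n - 1 with one of
its n vertices marked. Hence the growth from n ≥ 1 is n times the number of Motzkin paths of length
n - 1 (`humpCount_sub`). By `pathCount_eq` and `mul_trinomial_succ` this is n (T(n-1, 0) - T(n-1,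
2)) = T(n, 1).

Tableaux: by the branching rule (`numSYT_eq_sum`) a standard tableau is a chain of diagrams growing
from the empty one. Inside λ₃ ≤ 1 a new cell ends the first row, the second row or the first column;
once the second row is nonempty, these change λ₁ - λ₂ by 1, -1 and 0. So the chains are words
staying on or above the axis, in which no flat-step precedes the first down-step (`sum_growthCount`,
`hookSum_eq`). Their number grows by T(n, 1) by `lateFlatCount_succ_sub`. -/

namespace MotzkinHumps

/-! ### Trinomial coefficients and ballot numbers -/

/-- The number of words of length `k` in the three kinds of steps that end at height `e`. -/
def trinomial : ℕ → ℤ → ℤ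
  | 0, e => if e = 0 then 1 else 0
  | k + 1, e => trinomial k (e - 1) + trinomial k e + trinomial k (e + 1)

theorem trinomial_neg (k : ℕ) (e : ℤ) : trinomial k (-e) = trinomial k e := by
  induction k generalizing e with
  | zero => simp [trinomial]
  | succ k ih =>
    simp only [trinomial]
    rw [show -e - 1 = -(e + 1) by ring, show -e + 1 = -(e - 1) by ring, ih, ih, ih]
    ring

/-- Sum the rises of all steps over all words ending at `e`: each word contributes `e`, while each
of the `k + 1` positions contributes the words with an up-step there minus those with a down-step
there. -/
theorem mul_trinomial_succ (k : ℕ) (e : ℤ) :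
    e * trinomial (k + 1) e = (k + 1) * (trinomial k (e - 1) - trinomial k (e + 1)) := by
  induction k generalizing e with
  | zero =>
    simp only [trinomial]
    split_ifs <;> omega
  | succ k ih =>
    rw [trinomial]
    have h1 := ih (e - 1)
    have h2 := ih e
    have h3 := ih (e + 1)
    have e1 := trinomial.eq_2 (e - 1) k
    have e3 := trinomial.eq_2 (e + 1) k
    simp only [sub_add_cancel, add_sub_cancel_right] at h1 h3 e1 e3
    push_cast
    linear_combination h1 + h2 + h3 - (k + 1 : ℤ) * e1 + (k + 1 : ℤ) * e3

/-- The number of words of length `k` that stay on or above the axis when started at height `h`. -/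
def prefixCount : ℕ → ℕ → ℤ
  | 0, _ => 1
  | k + 1, 0 => prefixCount k 1 + prefixCount k 0
  | k + 1, h + 1 => prefixCount k (h + 2) + prefixCount k (h + 1) + prefixCount k h

/-- By the reflection principle, `prefixCount k h` is the sum of `trinomial k e` over -h ≤ e ≤ h +
1. The form by differences is the one that suits the induction. -/
theorem prefixCount_eq (k : ℕ) :
    prefixCount k 0 = trinomial k 0 + trinomial k 1 ∧
      ∀ h : ℕ, prefixCount k (h + 1) - prefixCount k h =
        trinomial k (h + 1) + trinomial k (h + 2) := by
  induction k with
  | zero =>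
    refine ⟨by simp [prefixCount, trinomial], fun h => ?_⟩
    simp only [prefixCount, trinomial]
    rw [if_neg (by omega), if_neg (by omega)]
    rfl
  | succ k ih =>
    obtain ⟨h0, hs⟩ := ih
    have hn := trinomial_neg k 1
    have s0 := hs 0
    constructor
    · simp only [prefixCount, trinomial]
      norm_num at s0 hn ⊢
      linarith
    · intro h
      have s1 := hs h
      have s2 := hs (h + 1)
      rcases h with _ | h
      · simp only [prefixCount, trinomial]
        norm_num at s0 s1 s2 hn ⊢
        linarith
      · have s3 := hs h
        simp only [prefixCount, trinomial]
        push_cast at s1 s2 s3 ⊢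
        ring_nf at s1 s2 s3 ⊢
        linarith

/-- The number of words of length `k` that continue `a` up-steps, stay on or above the axis, and
have a down-step before the first flat-step, if there is any. -/
def lateFlatCount : ℕ → ℕ → ℤ
  | 0, _ => 1
  | k + 1, 0 => lateFlatCount k 1
  | k + 1, a + 1 => lateFlatCount k (a + 2) + prefixCount k a

/-- The difference obeys the trinomial recurrence: the up-step supplies one term, and the difference
of prefix counts from `prefixCount_eq` supplies the other two. -/
theorem lateFlatCount_succ_sub (k a : ℕ) :
    lateFlatCount k (a + 1) - lateFlatCount k a = trinomial k (a + 1) := by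
  induction k generalizing a with
  | zero =>
    simp only [lateFlatCount, trinomial]
    rw [if_neg (by omega)]
    rfl
  | succ k ih =>
    obtain ⟨h0, hs⟩ := prefixCount_eq k
    have i1 := ih (a + 1)
    rcases a with _ | a
    · simp only [lateFlatCount, trinomial]
      norm_num at i1 ⊢
      linarith
    · have s := hs a
      simp only [lateFlatCount, trinomial]
      push_cast at i1 s ⊢
      ring_nf at i1 s ⊢
      linarith

/-! ### Motzkin paths from an arbitrary height -/

/-- The words of length `k` that lead from height `h` to the axis and stay on or above it. -/
def pathsFrom : ℕ → ℕ → Finset (List Step)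
  | 0, 0 => {[]}
  | 0, _ + 1 => ∅
  | k + 1, 0 => (pathsFrom k 1).image (List.cons .up) ∪ (pathsFrom k 0).image (List.cons .flat)
  | k + 1, h + 1 => (pathsFrom k (h + 2)).image (List.cons .up) ∪
      ((pathsFrom k (h + 1)).image (List.cons .flat) ∪ (pathsFrom k h).image (List.cons .down))

@[simp] theorem height_nil : height [] = 0 := rfl

@[simp] theorem height_cons (s : Step) (w : List Step) : height (s :: w) = s.rise + height w := by
  simp [height]

theorem forall_take_cons {h : ℤ} {s : Step} {w : List Step} :
    (∀ i, 0 ≤ h + height ((s :: w).take i)) ↔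
      0 ≤ h ∧ ∀ i, 0 ≤ h + s.rise + height (w.take i) := by
  constructor
  · intro H
    exact ⟨by simpa using H 0, fun i => by simpa [add_assoc] using H (i + 1)⟩
  · rintro ⟨h0, H⟩ (_ | i)
    · simpa using h0
    · simpa [add_assoc] using H i

theorem mem_pathsFrom {k h : ℕ} {w : List Step} :
    w ∈ pathsFrom k h ↔
      w.length = k ∧ (h : ℤ) + height w = 0 ∧ ∀ i, 0 ≤ (h : ℤ) + height (w.take i) := by
  induction k generalizing h w with
  | zero =>
    rcases h with _ | h <;> simp only [pathsFrom, List.length_eq_zero_iff, Finset.mem_singleton]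
    · constructor
      · rintro rfl; simp
      · exact fun H => H.1
    · constructor
      · simp
      · rintro ⟨rfl, H, -⟩
        simp at H
        omega
  | succ k ih =>
    rcases w with _ | ⟨s, w⟩
    · rcases h with _ | h <;> simp [pathsFrom]
    rw [forall_take_cons]
    rcases h with _ | h <;> rcases s <;>
      simp [pathsFrom, ih, Step.rise, add_assoc]
    · intro _ _
      exact ⟨0, by simp⟩
    · intro _
      rw [show (h : ℤ) + (1 + (1 + height w)) = h + (2 + height w) by ring]
      exact and_congr_right fun _ => ⟨fun H => ⟨by omega, H⟩, And.right⟩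
    · intros
      omega
    · intros
      omega

theorem motzkinPaths_eq (n : ℕ) : motzkinPaths n = pathsFrom n 0 := by
  ext w
  simp [mem_motzkinPaths, mem_pathsFrom, IsMotzkinPath]

theorem sum_pathsFrom_zero (k : ℕ) (f : List Step → ℤ) :
    ∑ w ∈ pathsFrom (k + 1) 0, f w =
      ∑ w ∈ pathsFrom k 1, f (.up :: w) + ∑ w ∈ pathsFrom k 0, f (.flat :: w) := by
  rw [pathsFrom, Finset.sum_union, Finset.sum_image, Finset.sum_image]
  · exact (List.cons_injective).injOn
  · exact (List.cons_injective).injOn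
  · simp [Finset.disjoint_left]

theorem sum_pathsFrom_succ (k h : ℕ) (f : List Step → ℤ) :
    ∑ w ∈ pathsFrom (k + 1) (h + 1), f w =
      ∑ w ∈ pathsFrom k (h + 2), f (.up :: w) + ∑ w ∈ pathsFrom k (h + 1), f (.flat :: w) +
        ∑ w ∈ pathsFrom k h, f (.down :: w) := by
  rw [pathsFrom, Finset.sum_union, Finset.sum_union, Finset.sum_image, Finset.sum_image,
    Finset.sum_image, add_assoc]
  · exact (List.cons_injective).injOn
  · exact (List.cons_injective).injOn
  · exact (List.cons_injective).injOn
  · simp [Finset.disjoint_left]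
  · rw [Finset.disjoint_left]
    simp

/-- The number of paths in `pathsFrom k h`. -/
def pathCount (k h : ℕ) : ℤ := ∑ _w ∈ pathsFrom k h, 1

/-- Ballot formula: reflection in height -1 turns the words that go below the axis into words with
endpoint displaced by `h + 2`. -/
theorem pathCount_eq (k h : ℕ) : pathCount k h = trinomial k h - trinomial k (h + 2) := by
  induction k generalizing h with
  | zero =>
    rcases h with _ | h
    · simp [pathCount, pathsFrom, trinomial]
    · simp only [pathCount, pathsFrom, Finset.sum_empty, trinomial]
      rw [if_neg (by omega), if_neg (by omega)]
      rfl
  | succ k ih =>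
    rcases h with _ | h
    · have hn := trinomial_neg k 1
      rw [pathCount, sum_pathsFrom_zero, ← pathCount, ← pathCount, ih, ih]
      simp only [trinomial]
      norm_num at hn ⊢
      linarith
    · rw [pathCount, sum_pathsFrom_succ, ← pathCount, ← pathCount, ← pathCount, ih, ih, ih]
      simp only [trinomial]
      push_cast
      ring_nf

/-! ### Counting humps -/

/-- The word starts with zero or more flat-steps followed by a down-step. -/
def StartsFlatDown (w : List Step) : Prop :=
  ∃ m : ℕ, (List.replicate m Step.flat ++ [Step.down]) <+: w

@[simp] theorem not_startsFlatDown_nil : ¬ StartsFlatDown [] := by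
  rintro ⟨m, h⟩
  simp at h

@[simp] theorem not_startsFlatDown_up (w : List Step) : ¬ StartsFlatDown (.up :: w) := by
  rintro ⟨_ | m, h⟩ <;> simp [List.replicate_succ] at h

@[simp] theorem startsFlatDown_flat (w : List Step) :
    StartsFlatDown (.flat :: w) ↔ StartsFlatDown w := by
  constructor
  · rintro ⟨_ | m, h⟩
    · simp at h
    · exact ⟨m, by simpa [List.replicate_succ] using h⟩
  · rintro ⟨m, h⟩
    exact ⟨m + 1, by simpa [List.replicate_succ] using h⟩

@[simp] theorem startsFlatDown_down (w : List Step) : StartsFlatDown (.down :: w) :=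
  ⟨0, by simp⟩

theorem isHumpAt_cons_zero (s : Step) (w : List Step) :
    IsHumpAt (s :: w) 0 ↔ s = .up ∧ StartsFlatDown w := by
  simp [IsHumpAt, StartsFlatDown, eq_comm]

open Classical in
/-- The indicator function of `StartsFlatDown`. -/
noncomputable def flatDownIndicator (w : List Step) : ℕ := if StartsFlatDown w then 1 else 0

@[simp] theorem flatDownIndicator_nil : flatDownIndicator [] = 0 :=
  if_neg not_startsFlatDown_nil

@[simp] theorem flatDownIndicator_up (w : List Step) : flatDownIndicator (.up :: w) = 0 :=
  if_neg (not_startsFlatDown_up w)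

@[simp] theorem flatDownIndicator_flat (w : List Step) :
    flatDownIndicator (.flat :: w) = flatDownIndicator w := by
  classical
  exact if_congr (startsFlatDown_flat w) rfl rfl

@[simp] theorem flatDownIndicator_down (w : List Step) : flatDownIndicator (.down :: w) = 1 :=
  if_pos (startsFlatDown_down w)

theorem humps_cons (s : Step) (w : List Step) :
    humps (s :: w) = humps w + if s = .up then flatDownIndicator w else 0 := by
  classical
  rw [humps, humps, Finset.card_filter, Finset.card_filter, List.length_cons,
    Finset.sum_range_succ', flatDownIndicator, ← ite_and]
  -- A hump at position `i + 1` of `s :: w` is by definition a hump at `i` of `w`; only position 0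
  -- is new.
  exact congrArg₂ _ rfl (if_congr (isHumpAt_cons_zero s w) rfl rfl)

/-- The number of paths in `pathsFrom k h` that start with flat-steps followed by a down-step. -/
noncomputable def flatDownCount (k h : ℕ) : ℤ := ∑ w ∈ pathsFrom k h, (flatDownIndicator w : ℤ)

theorem flatDownCount_succ (k h : ℕ) :
    flatDownCount (k + 1) (h + 1) = flatDownCount k (h + 1) + pathCount k h := by
  rw [flatDownCount, sum_pathsFrom_succ]
  simp [flatDownCount, pathCount]

theorem flatDownCount_zero (h : ℕ) : flatDownCount 0 h = 0 := by
  rcases h with _ | h <;> simp [flatDownCount, pathsFrom]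

/-- The total number of humps in the paths in `pathsFrom k h`. -/
noncomputable def humpCount (k h : ℕ) : ℤ := ∑ w ∈ pathsFrom k h, (humps w : ℤ)

theorem humpCount_zero (h : ℕ) : humpCount 0 h = 0 := by
  rcases h with _ | h <;> simp [humpCount, pathsFrom, humps]

theorem humpCount_succ_zero (k : ℕ) :
    humpCount (k + 1) 0 = humpCount k 1 + flatDownCount k 1 + humpCount k 0 := by
  rw [humpCount, sum_pathsFrom_zero]
  simp [humps_cons, humpCount, flatDownCount, Finset.sum_add_distrib]

theorem humpCount_succ_succ (k h : ℕ) :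
    humpCount (k + 1) (h + 1) = humpCount k (h + 2) + flatDownCount k (h + 2) +
      humpCount k (h + 1) + humpCount k h := by
  rw [humpCount, sum_pathsFrom_succ]
  simp [humps_cons, humpCount, flatDownCount, Finset.sum_add_distrib]

theorem humpCount_one (h : ℕ) : humpCount 1 h = 0 := by
  rcases h with _ | h <;>
    simp [humpCount_succ_zero, humpCount_succ_succ, humpCount_zero, flatDownCount_zero]

/-- The right side counts the peaks, by insertion of a peak at one of `k + 1` vertices. The
induction splits off the first step; the difference of `flatDownCount` terms is the extra copy of
`pathCount` that turns the factor `k + 1` into `k + 2`. -/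
theorem humpCount_sub (k h : ℕ) :
    humpCount (k + 2) h - humpCount (k + 1) h = (k + 1) * pathCount k h := by
  induction k generalizing h with
  | zero =>
    have h0 := humpCount_one
    rcases h with _ | h
    · rw [humpCount_succ_zero, h0, h0, flatDownCount_succ, flatDownCount_zero]
      simp
    · rw [humpCount_succ_succ, h0, h0, h0, flatDownCount_succ, flatDownCount_zero]
      simp
  | succ k ih =>
    rcases h with _ | h
    · have e : pathCount (k + 1) 0 = pathCount k 1 + pathCount k 0 := sum_pathsFrom_zero k _
      have f := flatDownCount_succ (k + 1) 0
      have g := humpCount_succ_zero (k + 1)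
      have g' := humpCount_succ_zero (k + 2)
      push_cast
      linear_combination g' - g + ih 1 + ih 0 + f - (k + 1 : ℤ) * e
    · have e : pathCount (k + 1) (h + 1) =
          pathCount k (h + 2) + pathCount k (h + 1) + pathCount k h := sum_pathsFrom_succ k h _
      have f := flatDownCount_succ (k + 1) (h + 1)
      have g := humpCount_succ_succ (k + 1) h
      have g' := humpCount_succ_succ (k + 2) h
      push_cast
      linear_combination g' - g + ih (h + 2) + ih (h + 1) + ih h + f - (k + 1 : ℤ) * e

theorem totalHumps_eq (n : ℕ) : (totalHumps n : ℤ) = humpCount n 0 := by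
  rw [totalHumps, motzkinPaths_eq, humpCount]
  push_cast
  rfl

theorem totalHumps_zero : totalHumps 0 = 0 := by
  have := totalHumps_eq 0
  rw [humpCount_zero] at this
  exact_mod_cast this

theorem totalHumps_succ (n : ℕ) :
    (totalHumps (n + 1) : ℤ) = totalHumps n + trinomial n 1 := by
  rw [totalHumps_eq, totalHumps_eq]
  rcases n with _ | n
  -- `humpCount_sub` only compares lengths from 1 on, so the passage from 0 to 1 is separate.
  · simp [humpCount_one, humpCount_zero, trinomial]
  · have h := humpCount_sub n 0
    have t := mul_trinomial_succ n 1
    rw [pathCount_eq] at h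
    norm_num at h t
    linarith

/-! ### The branching rule for standard Young tableaux -/

namespace IsStandard

variable {μ : YoungDiagram} {T : SemistandardYoungTableau μ}

theorem mem_Icc (hT : IsStandard T) {i j : ℕ} (h : (i, j) ∈ μ) : T i j ∈ Set.Icc 1 μ.card :=
  hT.mapsTo (x := (i, j)) h

theorem le_card (hT : IsStandard T) (i j : ℕ) : T i j ≤ μ.card := by
  by_cases h : (i, j) ∈ μ
  · exact (hT.mem_Icc h).2
  · rw [T.zeros h]
    exact Nat.zero_le _

end IsStandard

theorem tableau_le {μ : YoungDiagram} (T : SemistandardYoungTableau μ) {c d : ℕ × ℕ} (h : c ≤ d)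
    (hd : d ∈ μ) : T c.1 c.2 ≤ T d.1 d.2 :=
  (T.row_weak_of_le h.2 (μ.up_left_mem h.1 le_rfl hd)).trans (T.col_weak h.1 hd)

/-- The diagram `ν` arises from `μ` by removing one cell. -/
def IsCover (ν μ : YoungDiagram) : Prop := ν ≤ μ ∧ ν.card + 1 = μ.card

theorem IsCover.exists_insert {ν μ : YoungDiagram} (h : IsCover ν μ) :
    ∃ c, c ∉ ν.cells ∧ insert c ν.cells = μ.cells := by
  have hs := YoungDiagram.cells_subset_iff.2 h.1
  have h1 : (μ.cells \ ν.cells).card = 1 := by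
    have := Finset.card_sdiff_add_card_eq_card hs
    have := h.2
    simp only [YoungDiagram.card] at this
    omega
  obtain ⟨c, hc⟩ := Finset.card_eq_one.1 h1
  have hc' : c ∈ μ.cells \ ν.cells := by simp [hc]
  refine ⟨c, (Finset.mem_sdiff.1 hc').2, ?_⟩
  rw [Finset.insert_eq, ← hc, Finset.sdiff_union_of_subset hs]

/-- Extend a tableau to a diagram with one more cell by putting the largest entry there. -/
def extend {ν μ : YoungDiagram} (h : IsCover ν μ) (T : SemistandardYoungTableau ν)
    (hT : IsStandard T) : SemistandardYoungTableau μ where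
  entry i j := if (i, j) ∈ ν then T i j else if (i, j) ∈ μ then μ.card else 0
  row_weak' {i j1 j2} hj h2 := by
    have h1 : (i, j1) ∈ μ := μ.up_left_mem le_rfl hj.le h2
    by_cases hν : (i, j2) ∈ ν
    · have : (i, j1) ∈ ν := ν.up_left_mem le_rfl hj.le hν
      simp only [hν, this, if_true]
      exact T.row_weak hj hν
    · simp only [hν, h1, h2, if_true, if_false]
      split_ifs
      · exact (hT.le_card i j1).trans (by have := h.2; omega)
      · exact le_rfl
  col_strict' {i1 i2 j} hi h2 := by
    have h1 : (i1, j) ∈ μ := μ.up_left_mem hi.le le_rfl h2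
    by_cases hν : (i2, j) ∈ ν
    · have : (i1, j) ∈ ν := ν.up_left_mem hi.le le_rfl hν
      simp only [hν, this, if_true]
      exact T.col_strict hi hν
    -- Only one cell of `μ` is outside `ν`, and it is the lower one.
    · have h3 : (i1, j) ∈ ν := by
        obtain ⟨c, hc, hi'⟩ := h.exists_insert
        rw [← YoungDiagram.mem_cells, ← hi', Finset.mem_insert, YoungDiagram.mem_cells] at h1 h2
        rcases h1 with h1 | h1
        · rcases h2 with h2 | h2
          · rw [← h2, Prod.mk.injEq] at h1
            omega
          · exact absurd h2 hν
        · exact h1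
      simp only [hν, h2, h3, if_true, if_false]
      exact (hT.le_card i1 j).trans_lt (by have := h.2; omega)
  zeros' {i j} hn := by
    have : (i, j) ∉ ν := fun hν => hn (h.1 hν)
    simp [this, hn]

theorem extend_apply {ν μ : YoungDiagram} (h : IsCover ν μ) (T : SemistandardYoungTableau ν)
    (hT : IsStandard T) (i j : ℕ) :
    extend h T hT i j = if (i, j) ∈ ν then T i j else if (i, j) ∈ μ then μ.card else 0 := rfl

/-- Recovers the smaller diagram from the extended tableau, which makes extension injective across
different `ν`. -/
theorem mem_iff_extend_lt {ν μ : YoungDiagram} (h : IsCover ν μ) (T : SemistandardYoungTableau ν)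
    (hT : IsStandard T) (c : ℕ × ℕ) :
    c ∈ ν ↔ c ∈ μ ∧ extend h T hT c.1 c.2 < μ.card := by
  have hle := hT.le_card c.1 c.2
  have := h.2
  rw [extend_apply]
  constructor
  · intro hc
    rw [if_pos hc]
    exact ⟨h.1 hc, by omega⟩
  · rintro ⟨h1, h2⟩
    by_contra hc
    rw [if_neg hc, if_pos h1] at h2
    exact lt_irrefl _ h2

theorem isStandard_extend {ν μ : YoungDiagram} (h : IsCover ν μ) (T : SemistandardYoungTableau ν)
    (hT : IsStandard T) : IsStandard (extend h T hT) := by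
  obtain ⟨c, hc, hi⟩ := h.exists_insert
  have hcν : (c.1, c.2) ∉ ν := hc
  have hcμ : (c.1, c.2) ∈ μ := by
    rw [← YoungDiagram.mem_cells, ← hi]
    exact Finset.mem_insert_self _ _
  have hset : (μ : Set (ℕ × ℕ)) = insert c (ν : Set (ℕ × ℕ)) := by
    ext x
    have : x ∈ μ.cells ↔ x ∈ insert c ν.cells := by rw [hi]
    simpa using this
  have hIcc : Set.Icc 1 μ.card = insert (μ.card) (Set.Icc 1 ν.card) := by
    ext x
    have := h.2
    simp only [Set.mem_Icc, Set.mem_insert_iff]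
    omega
  have hval : extend h T hT c.1 c.2 = μ.card := by
    rw [extend_apply, if_neg hcν, if_pos hcμ]
  have hB : Set.BijOn (fun c : ℕ × ℕ => extend h T hT c.1 c.2) (ν : Set (ℕ × ℕ))
      (Set.Icc 1 ν.card) :=
    hT.congr fun x hx => by
      have hx' : (x.1, x.2) ∈ ν := hx
      simp only [extend_apply, if_pos hx']
  have := hB.insert (a := c) (by
    simp only [hval, Set.mem_Icc]
    have := h.2
    omega)
  simp only [hval] at this
  rw [IsStandard, hset, hIcc]
  exact this

/-- Remove from `μ` the cell that contains the largest entry of the tableau `T`. -/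
def lowerShape {μ : YoungDiagram} (T : SemistandardYoungTableau μ) : YoungDiagram where
  cells := μ.cells.filter fun c => T c.1 c.2 < μ.card
  isLowerSet c d hdc hc := by
    simp only [Finset.coe_filter, YoungDiagram.mem_cells, Set.mem_ofPred_eq] at hc ⊢
    exact ⟨μ.isLowerSet hdc hc.1, (tableau_le T hdc hc.1).trans_lt hc.2⟩

theorem mem_lowerShape {μ : YoungDiagram} {T : SemistandardYoungTableau μ} {c : ℕ × ℕ} :
    c ∈ lowerShape T ↔ c ∈ μ ∧ T c.1 c.2 < μ.card := by
  rw [← YoungDiagram.mem_cells, lowerShape, Finset.mem_filter, YoungDiagram.mem_cells]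

/-- Remove the largest entry of a tableau. -/
def restrict {μ : YoungDiagram} (T : SemistandardYoungTableau μ) :
    SemistandardYoungTableau (lowerShape T) where
  entry i j := if (i, j) ∈ lowerShape T then T i j else 0
  row_weak' {i j1 j2} hj h2 := by
    have h1 : (i, j1) ∈ lowerShape T := (lowerShape T).up_left_mem le_rfl hj.le h2
    simp only [h1, h2, if_true]
    exact T.row_weak hj (mem_lowerShape.1 h2).1
  col_strict' {i1 i2 j} hi h2 := by
    have h1 : (i1, j) ∈ lowerShape T := (lowerShape T).up_left_mem hi.le le_rfl h2
    simp only [h1, h2, if_true]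
    exact T.col_strict hi (mem_lowerShape.1 h2).1
  zeros' {i j} hn := if_neg hn

theorem restrict_apply {μ : YoungDiagram} (T : SemistandardYoungTableau μ) (i j : ℕ) :
    restrict T i j = if (i, j) ∈ lowerShape T then T i j else 0 := rfl

theorem bijOn_lowerShape {μ : YoungDiagram} {T : SemistandardYoungTableau μ} (hT : IsStandard T) :
    Set.BijOn (fun c : ℕ × ℕ => T c.1 c.2) (lowerShape T : Set (ℕ × ℕ))
      (Set.Icc 1 (μ.card - 1)) := by
  refine ⟨fun c hc => ?_, hT.injOn.mono fun c hc => (mem_lowerShape.1 hc).1, fun x hx => ?_⟩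
  · have h := mem_lowerShape.1 hc
    have := hT.mem_Icc h.1
    simp only [Set.mem_Icc] at this ⊢
    omega
  · rw [Set.mem_Icc] at hx
    obtain ⟨c, hc, hcx⟩ := hT.surjOn (show x ∈ Set.Icc 1 μ.card from ⟨hx.1, by omega⟩)
    refine ⟨c, mem_lowerShape.2 ⟨hc, ?_⟩, hcx⟩
    simp only at hcx
    omega

theorem card_lowerShape {μ : YoungDiagram} {T : SemistandardYoungTableau μ} (hT : IsStandard T) :
    (lowerShape T).card = μ.card - 1 := by
  have h := Nat.card_congr (bijOn_lowerShape hT).equiv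
  rw [Nat.card_eq_fintype_card (α := Set.Icc 1 (μ.card - 1)), Fintype.card_Icc] at h
  exact (Nat.subtype_card (lowerShape T).cells fun _ => Iff.rfl).symm.trans (by simpa using h)

theorem isCover_lowerShape {μ : YoungDiagram} {T : SemistandardYoungTableau μ}
    (hT : IsStandard T) (hμ : 0 < μ.card) : IsCover (lowerShape T) μ :=
  ⟨fun _ hc => (mem_lowerShape.1 hc).1, by rw [card_lowerShape hT]; omega⟩

theorem isStandard_restrict {μ : YoungDiagram} {T : SemistandardYoungTableau μ}
    (hT : IsStandard T) : IsStandard (restrict T) := by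
  rw [IsStandard, card_lowerShape hT]
  refine (bijOn_lowerShape hT).congr fun x hx => ?_
  have hx' : (x.1, x.2) ∈ lowerShape T := hx
  simp only [restrict_apply, if_pos hx']

theorem extend_restrict {μ : YoungDiagram} {T : SemistandardYoungTableau μ}
    (hT : IsStandard T) (hμ : 0 < μ.card) :
    extend (isCover_lowerShape hT hμ) (restrict T) (isStandard_restrict hT) = T := by
  refine SemistandardYoungTableau.ext fun i j => ?_
  rw [extend_apply, restrict_apply]
  split_ifs with h1 h2
  · rfl
  · have := hT.le_card i j
    have : ¬ T i j < μ.card := fun h => h1 (mem_lowerShape.2 ⟨h2, h⟩)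
    omega
  · exact (T.zeros h2).symm

instance (μ : YoungDiagram) : Finite {T : SemistandardYoungTableau μ // IsStandard T} :=
  finite_standard μ

/-- The largest entry sits in a removable corner; deleting it inverts `extend`. -/
theorem numSYT_eq_sum {μ : YoungDiagram} (hμ : 0 < μ.card) (s : Finset YoungDiagram)
    (hs : ∀ ν, ν ∈ s ↔ IsCover ν μ) : numSYT μ = ∑ ν ∈ s, numSYT ν := by
  let F : (Σ ν : s, {T : SemistandardYoungTableau ν.1 // IsStandard T}) →
      {T : SemistandardYoungTableau μ // IsStandard T} :=
    fun x => ⟨extend ((hs _).1 x.1.2) x.2.1 x.2.2, isStandard_extend _ _ _⟩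
  have hF : Function.Bijective F := by
    constructor
    · rintro ⟨⟨ν, hν⟩, T, hT⟩ ⟨⟨ν', hν'⟩, T', hT'⟩ h
      have h' : extend ((hs _).1 hν) T hT = extend ((hs _).1 hν') T' hT' :=
        congrArg Subtype.val h
      obtain rfl : ν = ν' := by
        refine SetLike.ext fun c => ?_
        rw [mem_iff_extend_lt ((hs _).1 hν) T hT, mem_iff_extend_lt ((hs _).1 hν') T' hT', h']
      obtain rfl : T = T' := by
        refine SemistandardYoungTableau.ext fun i j => ?_
        by_cases hc : (i, j) ∈ ν
        · have := congrArg (fun S => S i j) h'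
          simpa only [extend_apply, if_pos hc] using this
        · rw [T.zeros hc, T'.zeros hc]
      rfl
    · rintro ⟨T, hT⟩
      exact ⟨⟨⟨lowerShape T, (hs _).2 (isCover_lowerShape hT hμ)⟩, restrict T,
        isStandard_restrict hT⟩, Subtype.ext (extend_restrict hT hμ)⟩
  rw [numSYT, ← Nat.card_congr (Equiv.ofBijective F hF), Nat.card_sigma,
    ← Finset.sum_coe_sort s]
  rfl

/-! ### Adding a cell to a Young diagram -/

/-- A cell can be added at the end of the row with index `i`. -/
def Addable (ν : YoungDiagram) (i : ℕ) : Prop := ∀ i' < i, ν.rowLen i < ν.rowLen i'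

/-- Add a cell at the end of the row with index `i`. -/
def addCell (ν : YoungDiagram) (i : ℕ) (h : Addable ν i) : YoungDiagram where
  cells := insert (i, ν.rowLen i) ν.cells
  isLowerSet := by
    rintro ⟨a, b⟩ ⟨a', b'⟩ ⟨ha, hb⟩ hc
    simp only [Finset.coe_insert, Set.mem_insert_iff, Finset.mem_coe, YoungDiagram.mem_cells,
      Prod.mk.injEq] at hc ha hb ⊢
    rcases hc with ⟨rfl, rfl⟩ | hc
    · rw [YoungDiagram.mem_iff_lt_rowLen]
      rcases ha.lt_or_eq with h' | rfl
      · exact Or.inr (hb.trans_lt (h _ h'))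
      · omega
    · exact Or.inr (ν.up_left_mem ha hb hc)

theorem mem_addCell {ν : YoungDiagram} {i : ℕ} (h : Addable ν i) {c : ℕ × ℕ} :
    c ∈ addCell ν i h ↔ c = (i, ν.rowLen i) ∨ c ∈ ν := by
  rw [← YoungDiagram.mem_cells, addCell, Finset.mem_insert, YoungDiagram.mem_cells]

theorem rowLen_addCell {ν : YoungDiagram} {i : ℕ} (h : Addable ν i) (i' : ℕ) :
    (addCell ν i h).rowLen i' = ν.rowLen i' + if i' = i then 1 else 0 := by
  refine eq_of_forall_lt_iff fun j => ?_
  rw [← YoungDiagram.mem_iff_lt_rowLen, mem_addCell, YoungDiagram.mem_iff_lt_rowLen,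
    Prod.mk.injEq]
  split_ifs with hi
  · subst hi
    omega
  · simp [hi]

theorem rowLen_addCell_self {ν : YoungDiagram} {i : ℕ} (h : Addable ν i) :
    (addCell ν i h).rowLen i = ν.rowLen i + 1 := by simp [rowLen_addCell]

theorem isCover_addCell {ν : YoungDiagram} {i : ℕ} (h : Addable ν i) :
    IsCover ν (addCell ν i h) := by
  refine ⟨fun c hc => (mem_addCell h).2 (Or.inr hc), ?_⟩
  rw [YoungDiagram.card, YoungDiagram.card, addCell, Finset.card_insert_of_notMem]
  rw [YoungDiagram.mem_cells, YoungDiagram.mem_iff_lt_rowLen]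
  exact lt_irrefl _

theorem IsCover.exists_addCell {ν μ : YoungDiagram} (hc : IsCover ν μ) :
    ∃ i, ∃ h : Addable ν i, addCell ν i h = μ := by
  obtain ⟨⟨i, j⟩, hn, hi⟩ := hc.exists_insert
  have hm : ∀ d, d ∈ μ ↔ d = (i, j) ∨ d ∈ ν := fun d => by
    rw [← YoungDiagram.mem_cells, ← hi, Finset.mem_insert, YoungDiagram.mem_cells]
  have hij : (i, j) ∈ μ := (hm _).2 (Or.inl rfl)
  rw [YoungDiagram.mem_cells, YoungDiagram.mem_iff_lt_rowLen] at hn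
  obtain rfl : j = ν.rowLen i := by
    by_contra hne
    have := (hm _).1 (μ.up_left_mem le_rfl (not_lt.1 hn) hij)
    rw [YoungDiagram.mem_iff_lt_rowLen, Prod.mk.injEq] at this
    omega
  refine ⟨i, fun i' hi' => ?_, YoungDiagram.ext hi⟩
  have := (hm _).1 (μ.up_left_mem hi'.le le_rfl hij)
  rw [YoungDiagram.mem_iff_lt_rowLen, Prod.mk.injEq] at this
  omega

theorem addCell_injective {ν : YoungDiagram} {i i' : ℕ} (h : Addable ν i) (h' : Addable ν i')
    (e : addCell ν i h = addCell ν i' h') : i = i' := by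
  by_contra hne
  have := congrArg (fun μ => YoungDiagram.rowLen μ i) e
  simp [rowLen_addCell, hne] at this

theorem addable_zero (ν : YoungDiagram) : Addable ν 0 := fun _ h => absurd h (Nat.not_lt_zero _)

theorem addable_one {ν : YoungDiagram} : Addable ν 1 ↔ ν.rowLen 1 < ν.rowLen 0 :=
  ⟨fun h => h 0 one_pos, fun h i hi => by rwa [Nat.lt_one_iff.1 hi]⟩

theorem rowLen_pos_iff {ν : YoungDiagram} {i : ℕ} : 0 < ν.rowLen i ↔ i < ν.colLen 0 := by
  rw [← YoungDiagram.mem_iff_lt_rowLen, YoungDiagram.mem_iff_lt_colLen]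

theorem rowLen_colLen (ν : YoungDiagram) : ν.rowLen (ν.colLen 0) = 0 := by
  have := (rowLen_pos_iff (ν := ν) (i := ν.colLen 0)).1
  omega

theorem addable_colLen (ν : YoungDiagram) : Addable ν (ν.colLen 0) := fun i hi => by
  rw [rowLen_colLen]
  exact rowLen_pos_iff.2 hi

/-! ### Growing Young diagrams inside the hook -/

/-- The number of ways to add `k` cells one after the other to the diagram `ν` within the
diagrams that satisfy `λ₃ ≤ 1`. -/
def growthCount (k : ℕ) (ν : YoungDiagram) : ℤ :=
  if 0 < ν.rowLen 1 then prefixCount k (ν.rowLen 0 - ν.rowLen 1) else lateFlatCount k (ν.rowLen 0)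

/-- Covers correspond to addable rows. A row of index at least 2 may receive a cell only if it is
empty, since all such rows have length at most 1. -/
theorem sum_covers {ν : YoungDiagram} {s : Finset YoungDiagram}
    (hs : ∀ μ, μ ∈ s ↔ IsCover ν μ ∧ μ.rowLen 2 ≤ 1) (hν : ν.rowLen 2 ≤ 1) (t : Finset ℕ)
    (ht : ∀ i, i ∈ t ↔ Addable ν i ∧ (2 ≤ i → ν.rowLen i = 0)) (f : YoungDiagram → ℤ)
    (g : ℕ → ℤ) (hg : ∀ i h, f (addCell ν i h) = g i) :
    ∑ μ ∈ s, f μ = ∑ i ∈ t, g i := by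
  symm
  refine Finset.sum_bij (fun i hi => addCell ν i ((ht i).1 hi).1) (fun i hi => ?_)
    (fun i _ i' _ e => addCell_injective _ _ e) (fun μ hμ => ?_) fun i hi => (hg _ _).symm
  · refine (hs _).2 ⟨isCover_addCell _, ?_⟩
    rw [rowLen_addCell]
    have := ((ht i).1 hi).2
    split_ifs with h
    · subst h
      rw [this le_rfl]
    · exact hν
  · obtain ⟨hc, h2⟩ := (hs _).1 hμ
    obtain ⟨i, h, rfl⟩ := hc.exists_addCell
    refine ⟨i, (ht i).2 ⟨h, fun hi => ?_⟩, rfl⟩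
    rcases hi.eq_or_lt with rfl | hi
    · rw [rowLen_addCell_self] at h2
      omega
    · have := h 2 hi
      omega

/-- The step dictionary: growing the first row is an up-step, the second row a down-step, the first
column a flat-step. With an empty second row the column move coincides with starting the second row
or, for the empty diagram, the first row; so there is no flat-step yet. -/
theorem sum_growthCount {ν : YoungDiagram} {s : Finset YoungDiagram}
    (hs : ∀ μ, μ ∈ s ↔ IsCover ν μ ∧ μ.rowLen 2 ≤ 1) (hν : ν.rowLen 2 ≤ 1) (k : ℕ) :
    ∑ μ ∈ s, growthCount k μ = growthCount (k + 1) ν := by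
  have key : ∀ i, Addable ν i ∧ (2 ≤ i → ν.rowLen i = 0) ↔
      i = 0 ∨ (i = 1 ∧ ν.rowLen 1 < ν.rowLen 0) ∨ (i = ν.colLen 0 ∧ 0 < ν.rowLen 1) := by
    intro i
    constructor
    · rintro ⟨h, h2⟩
      rcases i with _ | _ | i
      · exact Or.inl rfl
      · exact Or.inr (Or.inl ⟨rfl, addable_one.1 h⟩)
      · refine Or.inr (Or.inr ⟨?_, ?_⟩)
        · have h3 := h (i + 1) (Nat.lt_succ_self _)
          have h4 := rowLen_pos_iff.1 (Nat.zero_lt_of_lt h3)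
          have h5 := mt rowLen_pos_iff.2 (h2 (by omega)).not_gt
          omega
        · exact Nat.zero_lt_of_lt (h 1 (by omega))
    · rintro (rfl | ⟨rfl, h⟩ | ⟨rfl, -⟩)
      · exact ⟨addable_zero ν, by omega⟩
      · exact ⟨addable_one.2 h, by omega⟩
      · exact ⟨addable_colLen ν, fun _ => rowLen_colLen ν⟩
  have hle := ν.rowLen_anti 0 1 zero_le_one
  -- A cell in row 2 or below leaves the first two rows, hence `growthCount`, unchanged.
  let g : ℕ → ℤ := fun i =>
    if i = 0 then
      if 0 < ν.rowLen 1 then prefixCount k (ν.rowLen 0 + 1 - ν.rowLen 1)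
        else lateFlatCount k (ν.rowLen 0 + 1)
    else if i = 1 then prefixCount k (ν.rowLen 0 - (ν.rowLen 1 + 1))
    else growthCount k ν
  have hg : ∀ i h, growthCount k (addCell ν i h) = g i := by
    intro i h
    simp only [g, growthCount, rowLen_addCell, eq_comm (a := i)]
    rcases i with _ | _ | i <;> simp
  by_cases h1 : 0 < ν.rowLen 1
  · have hc := rowLen_pos_iff.1 h1
    by_cases h2 : ν.rowLen 1 < ν.rowLen 0
    · rw [sum_covers hs hν {0, 1, ν.colLen 0} (fun i => by rw [key]; simp [h1, h2]) _ g hg,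
        Finset.sum_insert (by simp; omega), Finset.sum_insert (by simp; omega),
        Finset.sum_singleton]
      obtain ⟨d, hd⟩ := Nat.exists_eq_add_of_lt h2
      simp only [g, growthCount, h1, if_true, if_neg (show ν.colLen 0 ≠ 0 by omega),
        if_neg (show ν.colLen 0 ≠ 1 by omega), one_ne_zero, if_false]
      rw [show ν.rowLen 0 + 1 - ν.rowLen 1 = d + 2 by omega,
        show ν.rowLen 0 - (ν.rowLen 1 + 1) = d by omega,
        show ν.rowLen 0 - ν.rowLen 1 = d + 1 by omega, prefixCount]
      ring
    -- The first two rows are equal: height 0, where no down-step is allowed.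
    · rw [sum_covers hs hν {0, ν.colLen 0} (fun i => by rw [key]; simp [h1, h2]) _ g hg,
        Finset.sum_insert (by simp; omega), Finset.sum_singleton]
      simp only [g, growthCount, h1, if_true, if_neg (show ν.colLen 0 ≠ 0 by omega),
        if_neg (show ν.colLen 0 ≠ 1 by omega)]
      rw [show ν.rowLen 0 + 1 - ν.rowLen 1 = 1 by omega,
        show ν.rowLen 0 - ν.rowLen 1 = 0 by omega, prefixCount]
  · have h1' : ν.rowLen 1 = 0 := by omega
    rcases h0 : ν.rowLen 0 with _ | a
    · rw [sum_covers hs hν {0} (fun i => by rw [key]; simp [h1', h0]) _ g hg,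
        Finset.sum_singleton]
      simp [g, growthCount, h1', h0, lateFlatCount]
    · rw [sum_covers hs hν {0, 1} (fun i => by rw [key]; simp [h1', h0]) _ g hg,
        Finset.sum_insert (by simp), Finset.sum_singleton]
      simp [g, growthCount, h1', h0, lateFlatCount]

theorem rowLen_mono {ν μ : YoungDiagram} (h : ν ≤ μ) (i : ℕ) : ν.rowLen i ≤ μ.rowLen i := by
  refine le_of_forall_lt fun j hj => ?_
  rw [← YoungDiagram.mem_iff_lt_rowLen] at hj ⊢
  exact h hj

-- Double counting of the pairs in which `μ` covers `ν`: summing over `ν` gives `numSYT μ`, summing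
-- over `μ` gives `growthCount (k + 1) ν`.
open Classical in
theorem sum_numSYT_mul_growthCount_succ (m k : ℕ) :
    ∑ μ ∈ hookPartitions 2 1 (m + 1), (numSYT μ : ℤ) * growthCount k μ =
      ∑ ν ∈ hookPartitions 2 1 m, (numSYT ν : ℤ) * growthCount (k + 1) ν := by
  have h1 : ∀ μ ∈ hookPartitions 2 1 (m + 1), (numSYT μ : ℤ) * growthCount k μ =
      ∑ ν ∈ (hookPartitions 2 1 m).filter (IsCover · μ), (numSYT ν : ℤ) * growthCount k μ := by
    intro μ hμ
    rw [mem_hookPartitions] at hμ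
    rw [numSYT_eq_sum (by omega) ((hookPartitions 2 1 m).filter (IsCover · μ)), Nat.cast_sum,
      Finset.sum_mul]
    intro ν
    rw [Finset.mem_filter, mem_hookPartitions]
    -- The condition λ₃ ≤ 1 passes to subdiagrams, so no diagram covered by `μ` is lost.
    refine ⟨And.right, fun h => ⟨⟨?_, (rowLen_mono h.1 2).trans hμ.2⟩, h⟩⟩
    have := h.2
    omega
  have h2 : ∀ ν ∈ hookPartitions 2 1 m, (numSYT ν : ℤ) * growthCount (k + 1) ν =
      ∑ μ ∈ (hookPartitions 2 1 (m + 1)).filter (IsCover ν ·),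
        (numSYT ν : ℤ) * growthCount k μ := by
    intro ν hν
    rw [mem_hookPartitions] at hν
    rw [← Finset.mul_sum, sum_growthCount _ hν.2]
    intro μ
    rw [Finset.mem_filter, mem_hookPartitions]
    refine ⟨fun h => ⟨h.2, h.1.2⟩, fun h => ⟨⟨?_, h.2⟩, h.1⟩⟩
    have := h.1.2
    omega
  rw [Finset.sum_congr rfl h1, Finset.sum_congr rfl h2]
  refine Finset.sum_comm' fun μ ν => ?_
  simp only [Finset.mem_filter]
  tauto

theorem growthCount_zero (ν : YoungDiagram) : growthCount 0 ν = 1 := by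
  simp [growthCount, prefixCount, lateFlatCount]

/-- The sum depends only on `m + k`: at `k = 0` it is the hook sum, at `m = 0` only the empty
diagram remains. -/
theorem sum_numSYT_mul_growthCount (m k : ℕ) :
    ∑ μ ∈ hookPartitions 2 1 m, (numSYT μ : ℤ) * growthCount k μ = hookSum 2 1 (m + k) := by
  induction k generalizing m with
  | zero => simp [growthCount_zero, hookSum]
  | succ k ih => rw [← sum_numSYT_mul_growthCount_succ, ih, Nat.add_right_comm, Nat.add_assoc]

theorem rowLen_bot (i : ℕ) : (⊥ : YoungDiagram).rowLen i = 0 := by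
  by_contra h
  exact YoungDiagram.notMem_bot _ (YoungDiagram.mem_iff_lt_rowLen.2 (Nat.pos_of_ne_zero h))

theorem hookPartitions_zero : hookPartitions 2 1 0 = {⊥} := by
  ext μ
  rw [mem_hookPartitions, Finset.mem_singleton, YoungDiagram.card, Finset.card_eq_zero]
  constructor
  · rintro ⟨h, -⟩
    exact YoungDiagram.ext (by rw [h, YoungDiagram.cells_bot])
  · rintro rfl
    exact ⟨YoungDiagram.cells_bot, by rw [rowLen_bot]; omega⟩

theorem numSYT_bot : numSYT ⊥ = 1 := by
  rw [numSYT, Nat.card_eq_one_iff_unique]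
  refine ⟨⟨fun T T' => Subtype.ext (SemistandardYoungTableau.ext fun i j => ?_)⟩, ⟨default, ?_⟩⟩
  · rw [T.1.zeros (YoungDiagram.notMem_bot _), T'.1.zeros (YoungDiagram.notMem_bot _)]
  · simp [IsStandard, YoungDiagram.card, YoungDiagram.coe_bot]

theorem hookSum_eq (n : ℕ) : (hookSum 2 1 n : ℤ) = lateFlatCount n 0 := by
  have h := sum_numSYT_mul_growthCount 0 n
  rw [hookPartitions_zero, Finset.sum_singleton, numSYT_bot, zero_add] at h
  rw [← h]
  simp [growthCount, rowLen_bot]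

/-- The first step must be up, so `lateFlatCount (n + 1) 0` is `lateFlatCount n 1`. -/
theorem hookSum_succ (n : ℕ) :
    (hookSum 2 1 (n + 1) : ℤ) = hookSum 2 1 n + trinomial n 1 := by
  have h := lateFlatCount_succ_sub n 0
  rw [hookSum_eq, hookSum_eq, lateFlatCount]
  norm_num at h
  linarith

end MotzkinHumps

theorem theorem3p3 (n : ℕ) :
    (MotzkinHumps.totalHumps n : ℤ) = (MotzkinHumps.hookSum 2 1 n : ℤ) - 1 := by
  induction n with
  | zero =>
    rw [MotzkinHumps.hookSum_eq, MotzkinHumps.totalHumps_zero]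
    rfl
  | succ n ih =>
    rw [MotzkinHumps.totalHumps_succ, MotzkinHumps.hookSum_succ, ih]
    ring
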